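/- Let $G$ be a non-null graph (possibly infinite), and let $S,T\subseteq V(G)$. A path between $S$ and $T$ is a path of $G$ with one end in $S$ and the other end in $T$ (a single vertex of $S\cap T$ is such a path). The distance between two vertices is the number of edges of a shortest path of $G$ between them ($\infty$ if there is none), and the distance between two paths $P,Q$ is the minimum distance in $G$ between a vertex of $P$ and a vertex of $Q$. Then either \begin{itemize} \item there are two paths between $S$ and $T$ at distance at least $3$ from each other; or \item there exists $x\in V(G)$ such that every path between $S$ and $T$ contains a vertex at distance at most $161$ from $x$. \end{itemize} -/

import Mathlib

/-- The distance `d(X, Y)` between two sets of vertices of `G`: the least length of a path of `G`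
with one end in `X` and the other in `Y`, and `⊤` if there is no such path. -/
noncomputable def setDist {V : Type*} (G : SimpleGraph V) (X Y : Set V) : ℕ∞ :=
  ⨅ x ∈ X, ⨅ y ∈ Y, G.edist x y

/-- The path `P` of `G` is a path between `S` and `T`: it has one end in `S` and the other in `T`
(a one-vertex path is allowed when its vertex lies in both sets). -/
structure PathBetween {V : Type*} (G : SimpleGraph V) (S T : Set V) where
  /-- the end in `S` -/
  source : V
  /-- the end in `T` -/
  target : V
  source_mem : source ∈ S
  target_mem : target ∈ T
  /-- the path itself -/
  path : G.Path source target

/-- The vertex set of a path between `S` and `T`. -/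
def PathBetween.verts {V : Type*} {G : SimpleGraph V} {S T : Set V} (P : PathBetween G S T) :
    Set V :=
  {v | v ∈ (P.path : G.Walk P.source P.target).support}

/-! Take a shortest path between `S` and `T`, the spine, and the components of the graph left at
distance more than 8 from it. If no ball of radius 161 meets every path between `S` and `T`, a walk
avoiding the ball around a spine vertex must pass it inside one component, which attaches well
before and well after it (`bypassed`). Such components overlap along the spine and form a chain from
`S` to `T`, which acts like an augmenting path in Menger's theorem. Where components `t` and `t + 1`
overlap, the path on the spine leaves it at `a t` for component `t + 1`, and the path in component
`t` returns to the spine at the later position `b t`. Components too close to each other are merged: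
they go to the same path and no swap occurs.

Distance comes from choosing a cheapest chain, with cost 2 for a deep overlap and 3 for any other
link. One link cannot replace two steps (3 < 4). Two deep links through a bypassing component cannot
replace three steps (4 < 6), and can replace two only if both were deep. Hence components three or
more apart in the chain are far apart, and the turns occur in order along the spine with gaps of 30
(`add_le_of_mem_uIcc`). `not_within_two_of_half` compares all kinds of pieces. The delicate case, a
leg from the spine close to a bridge of the other path, yields a vertex near three consecutive
components; such triples are merged in advance. -/

open SimpleGraph

namespace CoarseMenger

variable {V : Type*} {G : SimpleGraph V} {S T : Set V}

/-! ### Bounded distance and connection inside a set -/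

/-- Some walk from `u` to `v` has length at most `k`. -/
def Within (G : SimpleGraph V) (k : ℕ) (u v : V) : Prop := ∃ w : G.Walk u v, w.length ≤ k

theorem Within.refl (k : ℕ) (u : V) : Within G k u u := ⟨.nil, by simp⟩

theorem Within.symm {k : ℕ} {u v : V} (h : Within G k u v) : Within G k v u :=
  let ⟨w, hw⟩ := h
  ⟨w.reverse, by simpa using hw⟩

theorem Within.trans {k l : ℕ} {u v x : V} (h : Within G k u v) (h' : Within G l v x) :
    Within G (k + l) u x :=
  let ⟨w, hw⟩ := h
  let ⟨w', hw'⟩ := h'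
  ⟨w.append w', by rw [Walk.length_append]; omega⟩

theorem Within.mono {k l : ℕ} {u v : V} (h : Within G k u v) (hkl : k ≤ l) : Within G l u v :=
  let ⟨w, hw⟩ := h
  ⟨w, hw.trans hkl⟩

theorem within_of_adj {u v : V} (h : G.Adj u v) : Within G 1 u v := ⟨h.toWalk, by simp⟩

theorem within_of_mem_support {u v z : V} (w : G.Walk u v) (hz : z ∈ w.support) :
    ∃ k l, k + l = w.length ∧ Within G k u z ∧ Within G l z v := by
  classical
  refine ⟨_, _, ?_, ⟨w.takeUntil z hz, le_rfl⟩, ⟨w.dropUntil z hz, le_rfl⟩⟩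
  rw [← Walk.length_append, Walk.take_spec]

theorem within_iff_edist_le {k : ℕ} {u v : V} : Within G k u v ↔ G.edist u v ≤ k := by
  constructor
  · rintro ⟨w, hw⟩
    exact (Walk.edist_le w).trans (by exact_mod_cast hw)
  · intro h
    obtain ⟨w, hw⟩ := exists_walk_of_edist_ne_top (ne_top_of_le_ne_top (ENat.natCast_ne_top k) h)
    exact ⟨w, by rw [← hw] at h; exact_mod_cast h⟩

/-- Some walk from `u` to `v` stays inside `X`. -/
def JoinedIn (G : SimpleGraph V) (X : Set V) (u v : V) : Prop :=
  ∃ w : G.Walk u v, ∀ z ∈ w.support, z ∈ X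

theorem JoinedIn.refl {X : Set V} {u : V} (h : u ∈ X) : JoinedIn G X u u := ⟨.nil, by simpa using h⟩

theorem JoinedIn.symm {X : Set V} {u v : V} (h : JoinedIn G X u v) : JoinedIn G X v u :=
  let ⟨w, hw⟩ := h
  ⟨w.reverse, by simpa using hw⟩

theorem JoinedIn.trans {X : Set V} {u v x : V} (h : JoinedIn G X u v) (h' : JoinedIn G X v x) :
    JoinedIn G X u x := by
  obtain ⟨w, hw⟩ := h
  obtain ⟨w', hw'⟩ := h'
  refine ⟨w.append w', fun z hz => ?_⟩
  rcases (Walk.mem_support_append_iff _ _).1 hz with hz | hz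
  exacts [hw z hz, hw' z hz]

theorem JoinedIn.mono {X Y : Set V} {u v : V} (h : JoinedIn G X u v) (hXY : X ⊆ Y) :
    JoinedIn G Y u v :=
  let ⟨w, hw⟩ := h
  ⟨w, fun z hz => hXY (hw z hz)⟩

theorem JoinedIn.mem_right {X : Set V} {u v : V} (h : JoinedIn G X u v) : v ∈ X :=
  let ⟨w, hw⟩ := h
  hw v w.end_mem_support

theorem joinedIn_of_adj {X : Set V} {u v : V} (h : G.Adj u v) (hu : u ∈ X) (hv : v ∈ X) :
    JoinedIn G X u v :=
  ⟨h.toWalk, by simp [hu, hv]⟩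

theorem JoinedIn.exists_pathBetween {X : Set V} {s t : V} (hs : s ∈ S) (ht : t ∈ T)
    (h : JoinedIn G X s t) : ∃ P : PathBetween G S T, P.verts ⊆ X := by
  classical
  obtain ⟨w, hw⟩ := h
  exact ⟨⟨s, t, hs, ht, w.toPath⟩, fun z hz => hw z (Walk.support_toPath_subset_support w hz)⟩

theorem three_le_setDist {X Y : Set V} (h : ∀ x ∈ X, ∀ y ∈ Y, ¬ Within G 2 x y) :
    3 ≤ setDist G X Y := by
  refine le_iInf₂ fun x hx => le_iInf₂ fun y hy => ?_
  by_contra hlt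
  refine h x hx y hy (within_iff_edist_le.2 ?_)
  have : G.edist x y < (2 : ℕ∞) + 1 := by
    have h3 : (2 : ℕ∞) + 1 = 3 := by norm_num
    rw [h3]; exact not_le.1 hlt
  exact_mod_cast Order.le_of_lt_add_one this

/-! ### The spine -/

/-- A shortest path `p 0, …, p n` between `S` and `T`, with integer indices. -/
structure Spine (G : SimpleGraph V) (S T : Set V) where
  /-- the vertices of the path -/
  p : ℤ → V
  /-- the length of the path -/
  n : ℤ
  n_nonneg : 0 ≤ n
  mem_S : p 0 ∈ S
  mem_T : p n ∈ T
  adj : ∀ i, 0 ≤ i → i < n → G.Adj (p i) (p (i + 1))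
  le_of_mem_S : ∀ s ∈ S, ∀ i, 0 ≤ i → i ≤ n → ∀ k : ℕ, Within G k s (p i) → i ≤ k
  le_of_mem_T : ∀ t ∈ T, ∀ i, 0 ≤ i → i ≤ n → ∀ k : ℕ, Within G k t (p i) → n - i ≤ k

theorem exists_spine (h : ∃ s ∈ S, ∃ t ∈ T, G.Reachable s t) : Nonempty (Spine G S T) := by
  classical
  have hex : ∃ n : ℕ, ∃ s ∈ S, ∃ t ∈ T, ∃ w : G.Walk s t, w.length = n := by
    obtain ⟨s, hs, t, ht, ⟨w⟩⟩ := h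
    exact ⟨_, s, hs, t, ht, w, rfl⟩
  obtain ⟨s, hs, t, ht, w, hw⟩ := Nat.find_spec hex
  have hmin : ∀ s' ∈ S, ∀ t' ∈ T, ∀ k : ℕ, Within G k s' t' → w.length ≤ k := by
    rintro s' hs' t' ht' k ⟨w', hw'⟩
    rw [hw]
    exact (Nat.find_min' hex ⟨s', hs', t', ht', w', rfl⟩).trans hw'
  have hpre : ∀ j ≤ w.length, Within G j s (w.getVert j) := fun j hj =>
    ⟨w.take j, by simp⟩
  have hsuf : ∀ j ≤ w.length, Within G (w.length - j) (w.getVert j) t := fun j hj =>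
    ⟨w.drop j, by simp⟩
  refine ⟨⟨fun i => w.getVert i.toNat, w.length, by simp, by simpa using hs, by simpa using ht,
    ?_, ?_, ?_⟩⟩
  · intro i hi hin
    have h1 : (i + 1).toNat = i.toNat + 1 := by omega
    simp only [h1]
    exact w.adj_getVert_succ (by omega)
  · intro s' hs' i hi hin k hk
    have := hmin s' hs' t ht _ (hk.trans (hsuf i.toNat (by omega)))
    omega
  · intro t' ht' i hi hin k hk
    have := hmin s hs t' ht' _ ((hpre i.toNat (by omega)).trans hk.symm)
    omega

namespace Spine

variable (P : Spine G S T)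

theorem within_of_le {i j : ℤ} (hi : 0 ≤ i) (hij : i ≤ j) (hj : j ≤ P.n) :
    Within G (j - i).toNat (P.p i) (P.p j) := by
  induction j, hij using Int.leInduction with
  | base => exact Within.refl _ _
  | succ j hij ih =>
    exact ((ih (by omega)).trans (within_of_adj (P.adj j (by omega) (by omega)))).mono (by omega)

theorem le_add_of_within {i j : ℤ} {k : ℕ} (hi : 0 ≤ i) (hin : i ≤ P.n) (hj : 0 ≤ j)
    (hjn : j ≤ P.n) (h : Within G k (P.p i) (P.p j)) : j ≤ i + k := by
  have := P.le_of_mem_S _ P.mem_S j hj hjn _ ((P.within_of_le le_rfl hi hin).trans h)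
  omega

theorem joinedIn_of_le {X : Set V} {i j : ℤ} (hi : 0 ≤ i) (hij : i ≤ j) (hj : j ≤ P.n)
    (hX : ∀ l, i ≤ l → l ≤ j → P.p l ∈ X) : JoinedIn G X (P.p i) (P.p j) := by
  induction j, hij using Int.leInduction with
  | base => exact .refl (hX i le_rfl le_rfl)
  | succ j hij ih =>
    exact (ih (by omega) fun l h1 h2 => hX l h1 (by omega)).trans
      (joinedIn_of_adj (P.adj j (by omega) (by omega)) (hX j hij (by omega))
        (hX (j + 1) (by omega) le_rfl))

theorem joinedIn_uIcc {X : Set V} {i j : ℤ} (hi : 0 ≤ i) (hin : i ≤ P.n) (hj : 0 ≤ j)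
    (hjn : j ≤ P.n) (hX : ∀ l ∈ Set.uIcc i j, P.p l ∈ X) : JoinedIn G X (P.p i) (P.p j) := by
  rcases le_total i j with h | h
  · exact P.joinedIn_of_le hi h hjn fun l h1 h2 => hX l (by rw [Set.uIcc_of_le h]; exact ⟨h1, h2⟩)
  · exact (P.joinedIn_of_le hj h hin fun l h1 h2 =>
      hX l (by rw [Set.uIcc_of_ge h]; exact ⟨h1, h2⟩)).symm

/-! ### Components away from the spine and their attachments -/

/-- The vertices at distance more than `8` from the spine. -/
def farSet : Set V := {v | ∀ i, 0 ≤ i → i ≤ P.n → ¬ Within G 8 v (P.p i)}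

/-- The connected component of `v` in the graph induced on `P.farSet`. -/
def comp (v : V) : Set V := {u | JoinedIn G P.farSet v u}

variable {P}

theorem mem_farSet {u v : V} (h : u ∈ P.comp v) : u ∈ P.farSet := JoinedIn.mem_right h

theorem mem_comp_of_adj {u u' v : V} (h : u ∈ P.comp v) (ha : G.Adj u u') (hu' : u' ∈ P.farSet) :
    u' ∈ P.comp v := JoinedIn.trans h (joinedIn_of_adj ha (mem_farSet h) hu')

theorem joinedIn_comp {v u u' : V} (h : u ∈ P.comp v) (h' : u' ∈ P.comp v) :
    JoinedIn G (P.comp v) u u' := by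
  have key : ∀ {u}, u ∈ P.comp v → JoinedIn G (P.comp v) v u := by
    classical
    rintro u ⟨w, hw⟩
    exact ⟨w, fun z hz => ⟨w.takeUntil z hz, fun y hy => hw y (w.support_takeUntil_subset_support hz hy)⟩⟩
  exact (key h).symm.trans (key h')

variable (P)

/-- The positions at which the component of `v` attaches to the spine; `-150` stands for `S` and
`P.n + 150` for `T`. -/
def att (v : V) : Set ℤ :=
  {x | (0 ≤ x ∧ x ≤ P.n ∧ ∃ u ∈ P.comp v, Within G 9 u (P.p x)) ∨
    (x = -150 ∧ ∃ u ∈ P.comp v, u ∈ S) ∨ (x = P.n + 150 ∧ ∃ u ∈ P.comp v, u ∈ T)}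

/-- The components of `v` and `v'` are at distance at most `k`. -/
def Near (k : ℕ) (v v' : V) : Prop := ∃ x ∈ P.comp v, ∃ y ∈ P.comp v', Within G k x y

/-- The component of `v` attaches much later than the component of `v'` does. -/
def Deep (v v' : V) : Prop := ∃ x ∈ P.att v, ∃ y ∈ P.att v', y + 60 ≤ x

/-- The component of `v` attaches later than the component of `v'`, or the two are close. -/
def Link (v v' : V) : Prop := (∃ x ∈ P.att v, ∃ y ∈ P.att v', y + 30 ≤ x) ∨ P.Near 4 v v'

variable {P}

theorem Near.symm {k : ℕ} {v v' : V} (h : P.Near k v v') : P.Near k v' v :=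
  let ⟨x, hx, y, hy, hxy⟩ := h
  ⟨y, hy, x, hx, hxy.symm⟩

theorem Near.mono {k l : ℕ} {v v' : V} (h : P.Near k v v') (hkl : k ≤ l) : P.Near l v v' :=
  let ⟨x, hx, y, hy, hxy⟩ := h
  ⟨x, hx, y, hy, hxy.mono hkl⟩

theorem Deep.link {v v' : V} (h : P.Deep v v') : P.Link v v' :=
  let ⟨x, hx, y, hy, hxy⟩ := h
  .inl ⟨x, hx, y, hy, by omega⟩

theorem att_of_adj {u e v : V} (hu : u ∈ P.comp v) (ha : G.Adj u e) (he : e ∉ P.farSet) :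
    ∃ x ∈ P.att v, 0 ≤ x ∧ x ≤ P.n ∧ Within G 8 e (P.p x) := by
  simp only [farSet, Set.mem_ofPred_eq, not_forall, not_not] at he
  obtain ⟨x, h0, hn, hx⟩ := he
  exact ⟨x, .inl ⟨h0, hn, u, hu, ((within_of_adj ha).trans hx).mono (by omega)⟩, h0, hn, hx⟩

/-- A walk that leaves a component passes next to an attachment. -/
theorem exists_exit {k : ℕ} {v u y : V} (hu : u ∈ P.comp v) (hy : y ∉ P.comp v)
    (h : Within G k u y) :
    ∃ e, e ∉ P.farSet ∧ Within G k e y ∧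
      ∃ x ∈ P.att v, 0 ≤ x ∧ x ≤ P.n ∧ Within G 8 e (P.p x) := by
  obtain ⟨w, hw⟩ := h
  induction w generalizing k with
  | nil => exact absurd hu hy
  | @cons a b c hab w ih =>
    rw [Walk.length_cons] at hw
    by_cases hb : b ∈ P.farSet
    · exact ih (mem_comp_of_adj hu hab hb) hy (by omega)
    · exact ⟨b, hb, ⟨w, by omega⟩, att_of_adj hu hab hb⟩

/-- Unless the components share a vertex, a short walk between them leaves each one next to the
spine, so some attachments differ by at most 8 + k + 8. -/
theorem Near.exists_att {k : ℕ} {v v' : V} (h : P.Near k v v') :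
    P.Near 0 v v' ∨ ∃ x ∈ P.att v, ∃ y ∈ P.att v', y ≤ x + (k + 16 : ℕ) := by
  obtain ⟨x, hx, y, hy, hxy⟩ := h
  by_cases hyv : y ∈ P.comp v
  · exact .inl ⟨y, hyv, y, hy, Within.refl _ _⟩
  obtain ⟨e, he, hey, i, hi, hi0, hin, hei⟩ := exists_exit hx hyv hxy
  obtain ⟨e', -, hee, j, hj, hj0, hjn, hej⟩ :=
    exists_exit hy (fun h => he (mem_farSet h)) hey.symm
  refine .inr ⟨i, hi, j, hj, P.le_add_of_within hi0 hin hj0 hjn ?_⟩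
  exact ((hei.symm.trans hee.symm).trans hej).mono (by omega)

/-! ### Bypassing components -/

variable (P) in
/-- Every position of the spine is bypassed by some component. -/
def Bypassed : Prop := ∀ i, 0 ≤ i → i ≤ P.n →
  ∃ z, (∃ x ∈ P.att z, x ≤ i - 150) ∧ ∃ y ∈ P.att z, i + 150 ≤ y

/-- Without a bypass, a walk avoiding the ball could never cross from the left of `i` to the right.
Since 161 = 8 + 153, its vertices near the spine are near positions more than 153 from `i`. -/
theorem bypassed (h : ∀ i, 0 ≤ i → i ≤ P.n →
    ∃ s ∈ S, ∃ t ∈ T, ∃ w : G.Walk s t, ∀ z ∈ w.support, ¬ Within G 161 z (P.p i)) :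
    P.Bypassed := by
  intro i hi0 hin
  by_contra hno
  obtain ⟨s, hs, t, ht, w, hw⟩ := h i hi0 hin
  have hself : ∀ {v}, v ∈ P.farSet → v ∈ P.comp v := fun hv => JoinedIn.refl hv
  -- `L u` says that `u` lies to the left of position `i`.
  let L : V → Prop := fun u =>
    (∃ j, 0 ≤ j ∧ j ≤ i ∧ Within G 8 u (P.p j)) ∨ (u ∈ P.farSet ∧ ∃ x ∈ P.att u, x ≤ i - 150)
  have hfar : ∀ {u j}, ¬ Within G 161 u (P.p i) → 0 ≤ j → j ≤ P.n → Within G 8 u (P.p j) →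
      j + 153 < i ∨ i + 153 < j := by
    intro u j hu h0 hn hj
    by_contra hc
    refine hu ?_
    rcases le_total i j with hij | hij
    · exact (hj.trans (P.within_of_le hi0 hij hn).symm).mono (by omega)
    · exact (hj.trans (P.within_of_le h0 hij hin)).mono (by omega)
  have hstart : L s := by
    by_cases hsF : s ∈ P.farSet
    · exact .inr ⟨hsF, -150, .inr (.inl ⟨rfl, s, hself hsF, hs⟩), by omega⟩
    · simp only [farSet, Set.mem_ofPred_eq, not_forall, not_not] at hsF
      obtain ⟨j, h0, hn, hj⟩ := hsF
      have := P.le_of_mem_S s hs j h0 hn 8 hj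
      rcases hfar (hw s w.start_mem_support) h0 hn hj with h | h
      · exact .inl ⟨j, h0, by omega, hj⟩
      · omega
  have hend : ¬ L t := by
    rintro (⟨j, h0, hji, hj⟩ | ⟨htF, x, hx, hxi⟩)
    · have := P.le_of_mem_T t ht j h0 (by omega) 8 hj
      rcases hfar (hw t w.end_mem_support) h0 (by omega) hj with h | h <;> omega
    · exact hno ⟨t, ⟨x, hx, hxi⟩, P.n + 150, .inr (.inr ⟨rfl, t, hself htF, ht⟩), by omega⟩
  have hstep : ∀ u u', G.Adj u u' → ¬ Within G 161 u (P.p i) → ¬ Within G 161 u' (P.p i) →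
      L u → L u' := by
    intro u u' ha hu hu' hL
    by_cases hF : u' ∈ P.farSet
    · refine .inr ⟨hF, ?_⟩
      rcases hL with ⟨j, h0, hji, hj⟩ | ⟨huF, x, hx, hxi⟩
      · refine ⟨j, .inl ⟨h0, by omega, u', hself hF,
          ((within_of_adj ha.symm).trans hj).mono (by omega)⟩, ?_⟩
        rcases hfar hu h0 (by omega) hj with h | h <;> omega
      · have hsub : P.comp u ⊆ P.comp u' := fun y hy =>
          (joinedIn_of_adj ha.symm hF huF).trans hy
        refine ⟨x, ?_, hxi⟩
        rcases hx with ⟨h0, hn, y, hy, h⟩ | ⟨h1, y, hy, h⟩ | ⟨h1, y, hy, h⟩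
        · exact .inl ⟨h0, hn, y, hsub hy, h⟩
        · exact .inr (.inl ⟨h1, y, hsub hy, h⟩)
        · exact .inr (.inr ⟨h1, y, hsub hy, h⟩)
    · have hF' := hF
      simp only [farSet, Set.mem_ofPred_eq, not_forall, not_not] at hF'
      obtain ⟨j', h0', hn', hj'⟩ := hF'
      rcases hfar hu' h0' hn' hj' with h | h
      · exact .inl ⟨j', h0', by omega, hj'⟩
      rcases hL with ⟨j, h0, hji, hj⟩ | ⟨huF, x, hx, hxi⟩
      · have := P.le_add_of_within h0 (by omega) h0' hn'
          ((hj.symm.trans (within_of_adj ha)).trans hj')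
        omega
      · refine absurd ⟨u, ⟨x, hx, hxi⟩, j', .inl ⟨h0', hn', u, hself huF,
          ((within_of_adj ha).trans hj').mono (by omega)⟩, by omega⟩ hno
  clear_value L
  clear hs ht
  induction w with
  | nil => exact hend hstart
  | @cons a b c hab w ih =>
    have hb : b ∈ (Walk.cons hab w).support := by simp
    exact ih (fun z hz => hw z (by simp [hz]))
      (hstep a b hab (hw a (Walk.start_mem_support _)) (hw b hb) hstart) hend

/-! ### Chains of minimum cost -/

/-- A chain of linked components; deep links cost `2` and others cost `3`. -/
inductive Chain (P : Spine G S T) (v : V) : V → ℕ → Prop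
  | nil : Chain P v v 0
  | deep {u w : V} {k : ℕ} : Chain P v u k → P.Deep u w → Chain P v w (k + 2)
  | link {u w : V} {k : ℕ} : Chain P v u k → P.Link u w → Chain P v w (k + 3)

theorem Chain.trans {v u w : V} {k l : ℕ} (h : Chain P v u k) (h' : Chain P u w l) :
    Chain P v w (k + l) := by
  induction h' with
  | nil => exact h
  | deep _ hd ih => exact ih.deep hd
  | link _ hd ih => exact ih.link hd

variable (P) in
/-- The component of `v` meets the set `A`. -/
def Meets (A : Set V) (v : V) : Prop := ∃ u ∈ P.comp v, u ∈ A

/-- A component reaching `i + 150` overlaps one bypassing `i + 1` by at least 299, so bypasses of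
successive positions are deeply linked. -/
theorem Bypassed.exists_chain (h : P.Bypassed) :
    ∃ k v v', P.Meets S v ∧ P.Meets T v' ∧ Chain P v v' k := by
  have key : ∀ i, 0 ≤ i → i ≤ P.n →
      ∃ k v v', P.Meets S v ∧ Chain P v v' k ∧ ∃ y ∈ P.att v', i + 150 ≤ y := by
    intro i hi
    induction i, hi using Int.leInduction with
    | base =>
      intro hn
      obtain ⟨z, ⟨x, hx, hxi⟩, hy⟩ := h 0 le_rfl hn
      -- Only the conventional position `-150` is this far left, so the component meets `S`.
      rcases hx with ⟨h0, _⟩ | ⟨-, hS⟩ | ⟨h0, _⟩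
      · omega
      · exact ⟨0, z, z, hS, .nil, hy⟩
      · have := P.n_nonneg; omega
    | succ i hi ih =>
      intro hn
      obtain ⟨k, v, v', hv, hc, y, hy, hiy⟩ := ih (by omega)
      obtain ⟨z, ⟨x, hx, hxi⟩, hy'⟩ := h (i + 1) (by omega) hn
      exact ⟨_, v, z, hv, hc.deep ⟨y, hy, x, hx, by omega⟩, hy'⟩
  obtain ⟨k, v, v', hv, hc, y, hy, hiy⟩ := key P.n P.n_nonneg le_rfl
  refine ⟨k, v, v', hv, ?_, hc⟩
  rcases hy with ⟨_, h0, _⟩ | ⟨h0, _⟩ | ⟨-, hT⟩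
  · omega
  · have := P.n_nonneg; omega
  · exact hT

theorem Chain.exists_seq {v v' : V} {k : ℕ} (h : Chain P v v' k) :
    ∃ (m : ℕ) (c : ℕ → V) (κ : ℕ → ℕ), c 0 = v ∧ c m = v' ∧ κ 0 = 0 ∧ κ m = k ∧
      ∀ t < m, (κ (t + 1) = κ t + 2 ∧ P.Deep (c t) (c (t + 1))) ∨
        (κ (t + 1) = κ t + 3 ∧ P.Link (c t) (c (t + 1))) := by
  have ext : ∀ {u w : V} {k a : ℕ}, (∃ (m : ℕ) (c : ℕ → V) (κ : ℕ → ℕ), c 0 = v ∧ c m = u ∧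
      κ 0 = 0 ∧ κ m = k ∧ ∀ t < m, (κ (t + 1) = κ t + 2 ∧ P.Deep (c t) (c (t + 1))) ∨
        (κ (t + 1) = κ t + 3 ∧ P.Link (c t) (c (t + 1)))) →
      (a = 2 ∧ P.Deep u w ∨ a = 3 ∧ P.Link u w) →
      ∃ (m : ℕ) (c : ℕ → V) (κ : ℕ → ℕ), c 0 = v ∧ c m = w ∧
      κ 0 = 0 ∧ κ m = k + a ∧ ∀ t < m, (κ (t + 1) = κ t + 2 ∧ P.Deep (c t) (c (t + 1))) ∨
        (κ (t + 1) = κ t + 3 ∧ P.Link (c t) (c (t + 1))) := by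
    rintro u w k a ⟨m, c, κ, h0, hm, hk0, hkm, hs⟩ ha
    refine ⟨m + 1, fun t => if t ≤ m then c t else w, fun t => if t ≤ m then κ t else k + a,
      by simpa, by simp, by simpa, by simp, fun t ht => ?_⟩
    rcases Nat.lt_succ_iff_lt_or_eq.1 ht with h | rfl
    · have h1 : t ≤ m := h.le
      have h2 : t + 1 ≤ m := h
      simpa [h1, h2] using hs t h
    · have h2 : ¬ t + 1 ≤ t := by omega
      simp only [le_refl, if_true, h2, if_false, hm, hkm]
      rcases ha with ⟨rfl, h⟩ | ⟨rfl, h⟩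
      exacts [.inl ⟨rfl, h⟩, .inr ⟨rfl, h⟩]
  induction h with
  | nil => exact ⟨0, fun _ => v, fun _ => 0, rfl, rfl, rfl, rfl, by simp⟩
  | deep _ hd ih => exact ext ih (.inl ⟨rfl, hd⟩)
  | link _ hd ih => exact ext ih (.inr ⟨rfl, hd⟩)

/-- A cheapest chain of components from `S` to `T`; `κ t` is the cost of its first `t` links. -/
structure MinChain (P : Spine G S T) where
  /-- the number of links -/
  m : ℕ
  /-- representatives of the components -/
  c : ℕ → V
  /-- partial costs -/
  κ : ℕ → ℕ
  meets_S : P.Meets S (c 0)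
  meets_T : P.Meets T (c m)
  κ_zero : κ 0 = 0
  step : ∀ t < m, (κ (t + 1) = κ t + 2 ∧ P.Deep (c t) (c (t + 1))) ∨
    (κ (t + 1) = κ t + 3 ∧ P.Link (c t) (c (t + 1)))
  minimal : ∀ v v' k, P.Meets S v → P.Meets T v' → Chain P v v' k → κ m ≤ k

theorem Bypassed.exists_minChain (h : P.Bypassed) : Nonempty (MinChain P) := by
  classical
  have hex := h.exists_chain
  obtain ⟨v, v', hv, hv', hc⟩ := Nat.find_spec hex
  obtain ⟨m, c, κ, h0, hm, hk0, hkm, hs⟩ := hc.exists_seq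
  refine ⟨⟨m, c, κ, h0 ▸ hv, hm ▸ hv', hk0, hs, fun u u' k hu hu' hk => ?_⟩⟩
  rw [hkm]
  exact Nat.find_min' hex ⟨u, u', hu, hu', hk⟩

namespace MinChain

variable (Q : MinChain P)

theorem link {t : ℕ} (ht : t < Q.m) : P.Link (Q.c t) (Q.c (t + 1)) := by
  rcases Q.step t ht with ⟨-, h⟩ | ⟨-, h⟩
  exacts [h.link, h]

theorem exists_chain {i j : ℕ} (hij : i ≤ j) (hj : j ≤ Q.m) :
    ∃ k, Q.κ j = Q.κ i + k ∧ 2 * (j - i) ≤ k ∧ Chain P (Q.c i) (Q.c j) k := by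
  induction j, hij using Nat.le_induction with
  | base => exact ⟨0, rfl, by simp, .nil⟩
  | succ j hij ih =>
    obtain ⟨k, hk, hk2, hc⟩ := ih (by omega)
    rcases Q.step j (by omega) with ⟨h, hd⟩ | ⟨h, hd⟩
    · exact ⟨k + 2, by omega, by omega, hc.deep hd⟩
    · exact ⟨k + 3, by omega, by omega, hc.link hd⟩

theorem κ_le_add {i j k : ℕ} (hij : i ≤ j) (hj : j ≤ Q.m) (h : Chain P (Q.c i) (Q.c j) k) :
    Q.κ j ≤ Q.κ i + k := by
  obtain ⟨k₁, hk₁, -, h₁⟩ := Q.exists_chain (Nat.zero_le i) (hij.trans hj)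
  obtain ⟨k₂, hk₂, -, h₂⟩ := Q.exists_chain hj le_rfl
  have := Q.minimal _ _ _ Q.meets_S Q.meets_T ((h₁.trans h).trans h₂)
  have := Q.κ_zero
  omega

theorem add_le_κ {i j : ℕ} (hij : i ≤ j) (hj : j ≤ Q.m) : Q.κ i + 2 * (j - i) ≤ Q.κ j := by
  obtain ⟨k, hk, hk2, -⟩ := Q.exists_chain hij hj
  omega

theorem not_link {i j : ℕ} (hij : i + 2 ≤ j) (hj : j ≤ Q.m) : ¬ P.Link (Q.c i) (Q.c j) := by
  intro h
  have := Q.κ_le_add (by omega) hj (Chain.nil.link h)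
  have := Q.add_le_κ (i := i) (j := j) (by omega) hj
  omega

theorem eq_zero_of_meets {i : ℕ} (hi : i ≤ Q.m) (h : P.Meets S (Q.c i)) : i = 0 := by
  obtain ⟨k, hk, -, h₂⟩ := Q.exists_chain hi le_rfl
  have := Q.minimal _ _ _ h Q.meets_T h₂
  have := Q.add_le_κ (Nat.zero_le i) hi
  have := Q.κ_zero
  omega

theorem eq_m_of_meets {i : ℕ} (hi : i ≤ Q.m) (h : P.Meets T (Q.c i)) : i = Q.m := by
  obtain ⟨k, hk, -, h₂⟩ := Q.exists_chain (Nat.zero_le i) hi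
  have := Q.minimal _ _ _ Q.meets_S h h₂
  have := Q.add_le_κ hi le_rfl
  have := Q.κ_zero
  omega

variable {Q}

/-- Otherwise the component bypassing `x` gives two deep links, of cost 4, in place of at least
three steps, of cost at least 6. The bypass margin suffices because 80 + 60 ≤ 150. -/
theorem add_le_of_att (hP : P.Bypassed) {i j : ℕ} (hij : i + 3 ≤ j) (hj : j ≤ Q.m) {x y : ℤ}
    (hx : x ∈ P.att (Q.c i)) (hy : y ∈ P.att (Q.c j)) : x + 80 ≤ y := by
  by_contra hlt
  rcases id hx with ⟨h0, hn, -⟩ | ⟨h0, -⟩ | ⟨-, hT⟩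
  · obtain ⟨z, ⟨x', hx', hxx⟩, y', hy', hyy⟩ := hP x h0 hn
    have := Q.κ_le_add (by omega) hj
      ((Chain.nil.deep ⟨x, hx, x', hx', by omega⟩).deep ⟨y', hy', y, hy, by omega⟩)
    have := Q.add_le_κ (i := i) (j := j) (by omega) hj
    omega
  · rcases id hy with ⟨h0', hn', -⟩ | ⟨-, hS⟩ | ⟨h0', -⟩
    · omega
    · have := Q.eq_zero_of_meets hj hS; omega
    · have := P.n_nonneg; omega
  · have := Q.eq_m_of_meets (by omega) hT; omega

theorem not_near (hP : P.Bypassed) {i j : ℕ} (hij : i + 3 ≤ j) (hj : j ≤ Q.m) {k : ℕ}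
    (hk : k ≤ 60) : ¬ P.Near k (Q.c i) (Q.c j) := by
  intro h
  rcases h.exists_att with h | ⟨x, hx, y, hy, hxy⟩
  · exact Q.not_link (by omega) hj (.inr (h.mono (by omega)))
  · have := add_le_of_att hP hij hj hx hy
    omega

/-- The detour through `z` costs 4, so by minimality neither of the two steps costs 3. -/
theorem deep_of_deep {i : ℕ} (hi : i + 2 ≤ Q.m) {z : V} (h : P.Deep (Q.c i) z)
    (h' : P.Deep z (Q.c (i + 2))) :
    P.Deep (Q.c i) (Q.c (i + 1)) ∧ P.Deep (Q.c (i + 1)) (Q.c (i + 2)) := by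
  have := Q.κ_le_add (by omega) hi ((Chain.nil.deep h).deep h')
  rcases Q.step i (by omega) with ⟨h1, hd⟩ | ⟨h1, -⟩ <;>
  rcases Q.step (i + 1) (by omega) with ⟨h2, hd'⟩ | ⟨h2, -⟩
  · exact ⟨hd, hd'⟩
  all_goals (rw [show i + 1 + 1 = i + 2 from rfl] at h2; omega)

/-! ### Merging, sides and turns -/

variable (Q)

/-- The vertex `z` is close to the components with indices `q`, `q + 1` and `q + 2`. -/
def IsCentre (q : ℕ) (z : V) : Prop :=
  q + 2 ≤ Q.m ∧ ∀ t, q ≤ t → t ≤ q + 2 → ∃ u ∈ P.comp (Q.c t), Within G 6 z u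

/-- The components with indices `t` and `t + 1` can be joined away from the spine. -/
def Merge (t : ℕ) : Prop :=
  P.Near 4 (Q.c t) (Q.c (t + 1)) ∨ ∃ q z, q ≤ t ∧ t ≤ q + 1 ∧ Q.IsCentre q z

theorem exists_turn {t : ℕ} (ht : t < Q.m) (h : ¬ Q.Merge t) :
    ∃ b a, b ∈ P.att (Q.c t) ∧ a ∈ P.att (Q.c (t + 1)) ∧ a + 30 ≤ b ∧
      (P.Deep (Q.c t) (Q.c (t + 1)) → a + 60 ≤ b) := by
  by_cases hd : P.Deep (Q.c t) (Q.c (t + 1))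
  · obtain ⟨b, hb, a, ha, hab⟩ := id hd
    exact ⟨b, a, hb, ha, by omega, fun _ => hab⟩
  · rcases Q.link ht with ⟨b, hb, a, ha, hab⟩ | hn
    · exact ⟨b, a, hb, ha, hab, fun h => absurd h hd⟩
    · exact absurd (.inl hn) h

/-- At each index `t` that is not merged, the position `b t` where one path leaves component `t` and
the earlier position `a t` where the other path enters component `t + 1`. -/
structure Turns (Q : MinChain P) where
  /-- exit positions -/
  b : ℕ → ℤ
  /-- entry positions -/
  a : ℕ → ℤ
  a_m : a Q.m = P.n
  mem_b : ∀ t < Q.m, ¬ Q.Merge t → b t ∈ P.att (Q.c t)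
  mem_a : ∀ t < Q.m, ¬ Q.Merge t → a t ∈ P.att (Q.c (t + 1))
  add_le : ∀ t < Q.m, ¬ Q.Merge t → a t + 30 ≤ b t
  deep : ∀ t < Q.m, ¬ Q.Merge t → P.Deep (Q.c t) (Q.c (t + 1)) → a t + 60 ≤ b t

theorem exists_turns : Nonempty Q.Turns := by
  have h : ∀ t, ∃ b a, (t = Q.m → a = P.n) ∧ (t < Q.m → ¬ Q.Merge t →
      b ∈ P.att (Q.c t) ∧ a ∈ P.att (Q.c (t + 1)) ∧ a + 30 ≤ b ∧
      (P.Deep (Q.c t) (Q.c (t + 1)) → a + 60 ≤ b)) := by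
    intro t
    by_cases ht : t < Q.m ∧ ¬ Q.Merge t
    · obtain ⟨b, a, h⟩ := Q.exists_turn ht.1 ht.2
      exact ⟨b, a, fun h => by omega, fun _ _ => h⟩
    · exact ⟨0, P.n, fun _ => rfl, fun h1 h2 => absurd ⟨h1, h2⟩ ht⟩
  choose b a h1 h2 using h
  exact ⟨⟨b, a, h1 _ rfl, fun t ht h => (h2 t ht h).1, fun t ht h => (h2 t ht h).2.1,
    fun t ht h => (h2 t ht h).2.2.1, fun t ht h => (h2 t ht h).2.2.2⟩⟩

open Classical in
/-- The side (one of two) to which the component of index `t` belongs. -/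
noncomputable def side : ℕ → Bool
  | 0 => true
  | t + 1 => if Q.Merge t then side t else !side t

variable {Q}

theorem side_succ_of_merge {t : ℕ} (h : Q.Merge t) : Q.side (t + 1) = Q.side t := by
  simp [side, h]

theorem side_succ_of_not_merge {t : ℕ} (h : ¬ Q.Merge t) : Q.side (t + 1) = !Q.side t := by
  simp [side, h]

theorem IsCentre.side_eq {q t : ℕ} {z : V} (h : Q.IsCentre q z) (h1 : q ≤ t) (h2 : t ≤ q + 2) :
    Q.side t = Q.side q := by
  have hm : Q.side (q + 1) = Q.side q :=
    side_succ_of_merge (.inr ⟨q, z, by omega, by omega, h⟩)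
  have hm' : Q.side (q + 1 + 1) = Q.side (q + 1) :=
    side_succ_of_merge (.inr ⟨q, z, by omega, by omega, h⟩)
  obtain rfl | rfl | rfl : t = q ∨ t = q + 1 ∨ t = q + 1 + 1 := by omega
  exacts [rfl, hm, hm'.trans hm]

/-- Components on different sides are not close. -/
theorem not_near_four {s t : ℕ} (hs : s ≤ Q.m) (ht : t ≤ Q.m) (h : Q.side s ≠ Q.side t) :
    ¬ P.Near 4 (Q.c s) (Q.c t) := by
  have key : ∀ {s t : ℕ}, s < t → t ≤ Q.m → Q.side s ≠ Q.side t →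
      ¬ P.Near 4 (Q.c s) (Q.c t) := by
    intro s t hst ht h hn
    rcases Nat.lt_or_ge (s + 1) t with h2 | h2
    · exact Q.not_link h2 ht (.inr hn)
    · obtain rfl : t = s + 1 := by omega
      exact h (side_succ_of_merge (.inl hn)).symm
  intro hn
  rcases lt_trichotomy s t with h' | rfl | h'
  · exact key h' ht h hn
  · exact h rfl
  · exact key h' hs h.symm hn.symm

/-! ### Order of the turns along the spine -/

namespace Turns

variable (R : Q.Turns)

theorem b_nonneg {t : ℕ} (ht : t < Q.m) (h : ¬ Q.Merge t) : 0 ≤ R.b t ∧ R.b t ≤ P.n := by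
  have hab := R.add_le t ht h
  have hn := P.n_nonneg
  rcases R.mem_b t ht h with ⟨h0, h1, -⟩ | ⟨h0, -⟩ | ⟨-, hT⟩
  · exact ⟨h0, h1⟩
  · rcases R.mem_a t ht h with ⟨h1, -⟩ | ⟨h1, -⟩ | ⟨h1, -⟩ <;> omega
  · have := Q.eq_m_of_meets ht.le hT; omega

theorem a_nonneg {t : ℕ} (ht : t < Q.m) (h : ¬ Q.Merge t) : 0 ≤ R.a t ∧ R.a t ≤ P.n := by
  have hab := R.add_le t ht h
  have hb := R.b_nonneg ht h
  rcases R.mem_a t ht h with ⟨h0, h1, -⟩ | ⟨-, hS⟩ | ⟨h0, -⟩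
  · exact ⟨h0, h1⟩
  · have := Q.eq_zero_of_meets ht hS; omega
  · omega

/-- The hard case is `t' = t + 1`. If the order failed, a bypass of `a t'` would make both steps
deep; then `b t` is at least 60 beyond `a t`, hence 30 beyond `a t'`, and components `t` and `t + 2`
would be linked. `b_add_le_b` is the mirror image. -/
theorem a_add_le_a (hP : P.Bypassed) {t t' : ℕ} (htt : t < t') (ht' : t' < Q.m)
    (h : ¬ Q.Merge t) (h' : ¬ Q.Merge t') : R.a t + 30 ≤ R.a t' := by
  have hab := R.add_le t (by omega) h
  rcases Nat.lt_or_ge (t + 1) t' with h2 | h2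
  · have := add_le_of_att hP (by omega) ht' (R.mem_b t (by omega) h) (R.mem_a t' ht' h')
    omega
  obtain rfl : t' = t + 1 := by omega
  by_contra hlt
  have ha := R.a_nonneg ht' h'
  obtain ⟨z, ⟨x, hx, hxx⟩, y, hy, hyy⟩ := hP _ ha.1 ha.2
  have hb := R.mem_b t (by omega) h
  have hd := R.deep t (by omega) h (deep_of_deep ht' (z := z) ⟨_, hb, x, hx, by omega⟩
    ⟨y, hy, _, R.mem_a _ ht' h', by omega⟩).1
  exact Q.not_link (i := t) (j := t + 2) le_rfl ht'
    (.inl ⟨_, hb, _, R.mem_a _ ht' h', by omega⟩)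

theorem b_add_le_b (hP : P.Bypassed) {t t' : ℕ} (htt : t < t') (ht' : t' < Q.m)
    (h : ¬ Q.Merge t) (h' : ¬ Q.Merge t') : R.b t + 30 ≤ R.b t' := by
  have hab := R.add_le t' ht' h'
  rcases Nat.lt_or_ge (t + 1) t' with h2 | h2
  · have := add_le_of_att hP (by omega) ht' (R.mem_b t (by omega) h) (R.mem_a t' ht' h')
    omega
  obtain rfl : t' = t + 1 := by omega
  by_contra hlt
  have hb0 := R.b_nonneg (by omega) h
  obtain ⟨z, ⟨x, hx, hxx⟩, y, hy, hyy⟩ := hP _ hb0.1 hb0.2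
  have hb := R.mem_b t (by omega) h
  have hd := R.deep _ ht' h' (deep_of_deep ht' (z := z) ⟨_, hb, x, hx, by omega⟩
    ⟨y, hy, _, R.mem_a _ ht' h', by omega⟩).2
  exact Q.not_link (i := t) (j := t + 2) le_rfl ht'
    (.inl ⟨_, hb, _, R.mem_a _ ht' h', by omega⟩)

open Classical in
/-- The position on the spine from which the path not using component `t` continues. -/
noncomputable def head : ℕ → ℤ
  | 0 => 0
  | t + 1 => if Q.Merge t then head t else R.b t

theorem head_cases (t : ℕ) :
    (R.head t = 0 ∧ ∀ j < t, Q.Merge j) ∨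
      ∃ j < t, ¬ Q.Merge j ∧ R.head t = R.b j ∧ ∀ i, j < i → i < t → Q.Merge i := by
  induction t with
  | zero => exact .inl ⟨rfl, by simp⟩
  | succ t ih =>
    by_cases h : Q.Merge t
    · have he : R.head (t + 1) = R.head t := by simp [head, h]
      rcases ih with ⟨h1, h2⟩ | ⟨j, hj, h1, h2, h3⟩
      · refine .inl ⟨he.trans h1, fun j hj => ?_⟩
        rcases Nat.lt_succ_iff_lt_or_eq.1 hj with hj | rfl
        exacts [h2 j hj, h]
      · refine .inr ⟨j, by omega, h1, he.trans h2, fun i hi hi' => ?_⟩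
        rcases Nat.lt_succ_iff_lt_or_eq.1 hi' with hj | rfl
        exacts [h3 i hi hj, h]
    · exact .inr ⟨t, by omega, h, by simp [head, h], fun i _ _ => by omega⟩

theorem head_nonneg {t : ℕ} (ht : t ≤ Q.m) : 0 ≤ R.head t ∧ R.head t ≤ P.n := by
  rcases R.head_cases t with ⟨h, -⟩ | ⟨j, hj, hm, h, -⟩
  · exact ⟨h.ge, h.trans_le P.n_nonneg⟩
  · rw [h]; exact R.b_nonneg (by omega) hm

/-- The path using the spine next to component `t` turns off the spine there, or ends. -/
def IsTurn (Q : MinChain P) (t : ℕ) : Prop := t ≤ Q.m ∧ (t < Q.m → ¬ Q.Merge t)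

theorem a_nonneg' {t : ℕ} (h : IsTurn Q t) : 0 ≤ R.a t ∧ R.a t ≤ P.n := by
  rcases h.1.lt_or_eq with ht | rfl
  · exact R.a_nonneg ht (h.2 ht)
  · rw [R.a_m]; exact ⟨P.n_nonneg, le_rfl⟩

/-- The stretches of the spine used by the two paths are in order and far apart. -/
theorem add_le_of_mem_uIcc (hP : P.Bypassed) {t t' : ℕ} (htt : t < t') (h : IsTurn Q t)
    (h' : IsTurn Q t') {i i' : ℤ} (hi : i ∈ Set.uIcc (R.head t) (R.a t))
    (hi' : i' ∈ Set.uIcc (R.head t') (R.a t')) : i + 30 ≤ i' := by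
  have htm : t < Q.m := htt.trans_le h'.1
  have hm := h.2 htm
  have hab := R.add_le t htm hm
  have ha0 := R.a_nonneg htm hm
  have hb0 := R.b_nonneg htm hm
  have haa : R.a t + 30 ≤ R.a t' := by
    rcases h'.1.lt_or_eq with ht' | rfl
    · exact R.a_add_le_a hP htt ht' hm (h'.2 ht')
    · rw [R.a_m]; omega
  -- The last unmerged index before `t'` is at least `t`, since `t` itself is unmerged.
  obtain ⟨j, hj, hjm, hjh, hji⟩ : ∃ j, j < t' ∧ ¬ Q.Merge j ∧ R.head t' = R.b j ∧ t ≤ j := by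
    rcases R.head_cases t' with ⟨-, h2⟩ | ⟨j, hj, h1, h2, h3⟩
    · exact absurd (h2 t htt) hm
    · refine ⟨j, hj, h1, h2, ?_⟩
      by_contra hlt
      exact hm (h3 t (by omega) htt)
  have hjlt : j < Q.m := hj.trans_le h'.1
  have hjab := R.add_le j hjlt hjm
  have hah : R.a t + 30 ≤ R.head t' := by
    rw [hjh]
    rcases hji.lt_or_eq with hlt | rfl
    · have := R.a_add_le_a hP hlt hjlt hm hjm; omega
    · exact hab
  have hhead : R.head t + 30 ≤ R.head t' ∧ R.head t + 30 ≤ R.a t' := by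
    rcases R.head_cases t with ⟨h0, -⟩ | ⟨i, hi, him, hih, -⟩
    · omega
    · have hbt := R.b_add_le_b hP hi htm him hm
      constructor
      · rw [hih, hjh]; exact R.b_add_le_b hP (by omega) hjlt him hjm
      · rcases h'.1.lt_or_eq with ht' | rfl
        · have := add_le_of_att hP (by omega) ht' (R.mem_b i (by omega) him)
            (R.mem_a t' ht' (h'.2 ht'))
          omega
        · rw [R.a_m, hih]; omega
  rw [Set.mem_uIcc] at hi hi'
  omega

/-- Merges change neither head nor side, so a stretch of spine begun at a head runs on to the next
turn. -/
theorem exists_isTurn {t : ℕ} (ht : t ≤ Q.m) :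
    ∃ t', IsTurn Q t' ∧ R.head t' = R.head t ∧ Q.side t' = Q.side t := by
  induction hd : Q.m - t generalizing t with
  | zero => exact ⟨t, ⟨ht, fun h => by omega⟩, rfl, rfl⟩
  | succ d ih =>
    by_cases h : Q.Merge t
    · obtain ⟨t', h1, h2, h3⟩ := ih (t := t + 1) (by omega) (by omega)
      exact ⟨t', h1, h2.trans (by simp [head, h]), h3.trans (side_succ_of_merge h)⟩
    · exact ⟨t, ⟨ht, fun _ => h⟩, rfl, rfl⟩

end Turns

/-! ### Bridges and stars -/

variable (Q) in
/-- The vertex `u` is at distance at most `k` from the component of index `t`. -/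
def Close (k : ℕ) (u : V) (t : ℕ) : Prop := ∃ y ∈ P.comp (Q.c t), Within G k u y

theorem Close.near {k l : ℕ} {u v : V} {s t : ℕ} (hu : Q.Close k u s) (hv : Q.Close l v t)
    (h : Within G 2 u v) : P.Near (k + 2 + l) (Q.c s) (Q.c t) :=
  let ⟨x, hx, hux⟩ := hu
  let ⟨y, hy, hvy⟩ := hv
  ⟨x, hx, y, hy, (hux.symm.trans h).trans hvy⟩

theorem Close.mono {k l : ℕ} {u : V} {t : ℕ} (h : Q.Close k u t) (hkl : k ≤ l) : Q.Close l u t :=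
  let ⟨y, hy, huy⟩ := h
  ⟨y, hy, huy.mono hkl⟩

theorem Close.trans {k l : ℕ} {u v : V} {t : ℕ} (huv : Within G k u v) (h : Q.Close l v t) :
    Q.Close (k + l) u t :=
  let ⟨y, hy, huy⟩ := h
  ⟨y, hy, huv.trans huy⟩

theorem Close.not_within {k l : ℕ} {u : V} {t : ℕ} (h : Q.Close k u t) {i : ℤ} (hi : 0 ≤ i)
    (hin : i ≤ P.n) (hkl : k + l ≤ 8) : ¬ Within G l u (P.p i) := by
  obtain ⟨y, hy, huy⟩ := h
  exact fun hu => mem_farSet hy i hi hin ((huy.symm.trans hu).mono hkl)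

theorem Close.index_le (hP : P.Bypassed) {k l : ℕ} {u v : V} {s t : ℕ} (hs : s ≤ Q.m)
    (ht : t ≤ Q.m) (hu : Q.Close k u s) (hv : Q.Close l v t) (h : Within G 2 u v)
    (hkl : k + l ≤ 58) : s ≤ t + 2 ∧ t ≤ s + 2 := by
  have hn := hu.near hv h
  constructor
  · by_contra hlt
    exact not_near hP (by omega) hs (by omega) hn.symm
  · by_contra hlt
    exact not_near hP (by omega) ht (by omega) hn

variable (Q)

/-- The vertices of the short paths joining components `t` and `t + 1`. -/
def bridge (t : ℕ) : Set V :=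
  {u | ∃ k l, k + l ≤ 4 ∧ Q.Close k u t ∧ Q.Close l u (t + 1)}

/-- The vertices of the short paths joining components `q`, `q + 1`, `q + 2` through a centre. -/
def star (q : ℕ) : Set V :=
  {u | ∃ z, Q.IsCentre q z ∧ Within G 6 z u ∧ ∃ t, q ≤ t ∧ t ≤ q + 2 ∧ Q.Close 6 u t}

variable {Q}

theorem close_of_mem_star {q t : ℕ} {u : V} (hu : u ∈ Q.star q) (h1 : q ≤ t) (h2 : t ≤ q + 2) :
    q + 2 ≤ Q.m ∧ Q.Close 12 u t ∧ Q.side t = Q.side q := by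
  obtain ⟨z, hz, hzu, -⟩ := hu
  obtain ⟨y, hy, hzy⟩ := hz.2 t h1 h2
  exact ⟨hz.1, ⟨y, hy, hzu.symm.trans hzy⟩, hz.side_eq h1 h2⟩

theorem merge_of_mem_bridge {t : ℕ} {u : V} (hu : u ∈ Q.bridge t) : Q.Merge t := by
  obtain ⟨k, l, hkl, ⟨x, hx, hux⟩, y, hy, huy⟩ := hu
  exact .inl ⟨x, hx, y, hy, (hux.symm.trans huy).mono hkl⟩

theorem close_of_mem_bridge {t : ℕ} {u : V} (hu : u ∈ Q.bridge t) :
    Q.Close 4 u t ∧ Q.Close 4 u (t + 1) ∧ (Q.Close 2 u t ∨ Q.Close 2 u (t + 1)) ∧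
      Q.side (t + 1) = Q.side t := by
  have hs := side_succ_of_merge (merge_of_mem_bridge hu)
  obtain ⟨k, l, hkl, h1, h2⟩ := hu
  refine ⟨h1.mono (by omega), h2.mono (by omega), ?_, hs⟩
  rcases Nat.lt_or_ge 2 k with hk | hk
  exacts [.inr (h2.mono (by omega)), .inl (h1.mono hk)]

/-- A star is far from whatever lies close to a component on the other side. -/
theorem not_within_two_of_star (hP : P.Bypassed) {q s k : ℕ} {u v : V} (hs : s ≤ Q.m)
    (hu : u ∈ Q.star q) (hv : Q.Close k v s) (hk : k ≤ 46) (hne : Q.side q ≠ Q.side s) :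
    ¬ Within G 2 u v := by
  intro h
  have h0 := close_of_mem_star hu le_rfl (Nat.le_add_right q 2)
  have h2 := close_of_mem_star hu (Nat.le_add_right q 2) le_rfl
  -- Closeness to components `q` and `q + 2` forces `q ≤ s ≤ q + 2`, so `s` belongs to the merged
  -- triple.
  have e0 := h0.2.1.index_le hP (by omega) hs hv h (by omega)
  have e2 := h2.2.1.index_le hP h0.1 hs hv h (by omega)
  exact hne (close_of_mem_star hu (t := s) (by omega) (by omega)).2.2.symm

theorem not_within_two_of_bridge_comp {t s : ℕ} {u v : V} (ht : t < Q.m) (hs : s ≤ Q.m)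
    (hu : u ∈ Q.bridge t) (hv : v ∈ P.comp (Q.c s)) (hne : Q.side t ≠ Q.side s) :
    ¬ Within G 2 u v := by
  intro h
  have hv0 : Q.Close 0 v s := ⟨v, hv, Within.refl _ _⟩
  obtain ⟨-, -, hc | hc, he⟩ := close_of_mem_bridge hu
  · exact not_near_four ht.le hs hne (hc.near hv0 h)
  · exact not_near_four (s := t + 1) ht hs (he ▸ hne) (hc.near hv0 h)

theorem not_within_two_of_bridges (hP : P.Bypassed) {t s : ℕ} {u v : V} (ht : t < Q.m)
    (hs : s < Q.m) (hu : u ∈ Q.bridge t) (hv : v ∈ Q.bridge s) (hne : Q.side t ≠ Q.side s) :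
    ¬ Within G 2 u v := by
  intro h
  obtain ⟨hu0, hu1, -, hue⟩ := close_of_mem_bridge hu
  obtain ⟨hv0, hv1, -, hve⟩ := close_of_mem_bridge hv
  have h1 := hu0.index_le hP ht.le hs hv1 h (by omega)
  have h2 := hu1.index_le hP ht hs.le hv0 h (by omega)
  obtain rfl | rfl | rfl : t = s ∨ t = s + 1 ∨ s = t + 1 := by omega
  · exact hne rfl
  · exact hne hve
  · exact hne hue.symm

theorem not_within_two_of_comps {t s : ℕ} {u v : V} (ht : t ≤ Q.m) (hs : s ≤ Q.m)
    (hu : u ∈ P.comp (Q.c t)) (hv : v ∈ P.comp (Q.c s)) (hne : Q.side t ≠ Q.side s) :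
    ¬ Within G 2 u v :=
  fun h => not_near_four ht hs hne ⟨u, hu, v, hv, h.mono (by omega)⟩

/-! ### Trunks and separation of the two halves -/

namespace Turns

variable (R : Q.Turns)

/-- The stretch of the spine that ends at the turn `t`, with the short paths from it to components
on its side. -/
def trunk (t : ℕ) : Set V :=
  {u | ∃ i ∈ Set.uIcc (R.head t) (R.a t), u = P.p i ∨
    ∃ s ≤ Q.m, Q.side s ≠ Q.side t ∧ ∃ k l, k + l ≤ 9 ∧ Within G k (P.p i) u ∧ Q.Close l u s}

theorem uIcc_nonneg {t : ℕ} (h : IsTurn Q t) {i : ℤ} (hi : i ∈ Set.uIcc (R.head t) (R.a t)) :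
    0 ≤ i ∧ i ≤ P.n := by
  have h1 := R.head_nonneg h.1
  have h2 := R.a_nonneg' h
  rw [Set.mem_uIcc] at hi
  omega

theorem within_of_mem_trunk {t : ℕ} {u : V} (hu : u ∈ R.trunk t) :
    ∃ i ∈ Set.uIcc (R.head t) (R.a t), Within G 9 (P.p i) u := by
  obtain ⟨i, hi, rfl | ⟨s, -, -, k, l, hkl, hk, -⟩⟩ := hu
  · exact ⟨i, hi, Within.refl _ _⟩
  · exact ⟨i, hi, hk.mono (by omega)⟩

/-- Trunk vertices are within 9 of their stretches, and 9 + 2 + 9 < 30. -/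
theorem not_within_two_of_trunks (hP : P.Bypassed) {t t' : ℕ} {u v : V} (h : IsTurn Q t)
    (h' : IsTurn Q t') (hu : u ∈ R.trunk t) (hv : v ∈ R.trunk t')
    (hne : Q.side t ≠ Q.side t') : ¬ Within G 2 u v := by
  intro huv
  obtain ⟨i, hi, hiu⟩ := R.within_of_mem_trunk hu
  obtain ⟨j, hj, hjv⟩ := R.within_of_mem_trunk hv
  have hi0 := R.uIcc_nonneg h hi
  have hj0 := R.uIcc_nonneg h' hj
  have hij := (hiu.trans huv).trans hjv.symm
  have h1 := P.le_add_of_within hi0.1 hi0.2 hj0.1 hj0.2 hij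
  have h2 := P.le_add_of_within hj0.1 hj0.2 hi0.1 hi0.2 hij.symm
  rcases lt_trichotomy t t' with hlt | rfl | hlt
  · have := R.add_le_of_mem_uIcc hP hlt h h' hi hj; omega
  · exact hne rfl
  · have := R.add_le_of_mem_uIcc hP hlt h' h hj hi; omega

/-- Components avoid the 8-neighbourhood of the spine, so a leg vertex within 2 of one is at least 7
along its leg, hence within 2 of the leg's own component. The two components are then within 4. -/
theorem not_within_two_of_trunk_comp {t s : ℕ} {u v : V} (h : IsTurn Q t) (hs : s ≤ Q.m)
    (hu : u ∈ R.trunk t) (hv : v ∈ P.comp (Q.c s)) (he : Q.side t = Q.side s) :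
    ¬ Within G 2 u v := by
  intro huv
  have hv0 : Q.Close 0 v s := ⟨v, hv, Within.refl _ _⟩
  obtain ⟨i, hi, rfl | ⟨s', hs', hne, k, l, hkl, hk, hl⟩⟩ := hu
  · have hi0 := R.uIcc_nonneg h hi
    exact hv0.not_within (l := 2) hi0.1 hi0.2 (by omega) huv.symm
  · have hi0 := R.uIcc_nonneg h hi
    have hk7 : 7 ≤ k := by
      by_contra hlt
      exact hv0.not_within (l := k + 2) hi0.1 hi0.2 (by omega) (hk.trans huv).symm
    exact not_near_four hs' hs (he ▸ hne) ((hl.near hv0 huv).mono (by omega))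

theorem not_within_two_of_trunk_star (hP : P.Bypassed) {t q : ℕ} {u v : V} (h : IsTurn Q t)
    (hu : u ∈ R.trunk t) (hv : v ∈ Q.star q) (he : Q.side t = Q.side q) : ¬ Within G 2 u v := by
  intro huv
  obtain ⟨i, hi, rfl | ⟨s, hs, hne, k, l, hkl, hk, hl⟩⟩ := hu
  · have hi0 := R.uIcc_nonneg h hi
    obtain ⟨z, -, -, t', -, -, hc⟩ := hv
    exact hc.not_within (l := 2) hi0.1 hi0.2 (by omega) huv.symm
  · exact not_within_two_of_star hP hs hv hl (by omega) (he ▸ hne.symm) huv.symm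

theorem not_within_two_of_trunk_bridge (hP : P.Bypassed) {t s : ℕ} {u v : V} (h : IsTurn Q t)
    (hs : s < Q.m) (hu : u ∈ R.trunk t) (hv : v ∈ Q.bridge s) (he : Q.side t = Q.side s) :
    ¬ Within G 2 u v := by
  intro huv
  obtain ⟨hc0, hc1, hc, hse⟩ := close_of_mem_bridge hv
  obtain ⟨r, hr⟩ : ∃ r, Q.Close 2 v r := by
    rcases hc with hc | hc
    exacts [⟨_, hc⟩, ⟨_, hc⟩]
  obtain ⟨i, hi, rfl | ⟨s', hs', hne, k, l, hkl, hk, hl⟩⟩ := hu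
  · have hi0 := R.uIcc_nonneg h hi
    exact hr.not_within (l := 2) hi0.1 hi0.2 (by omega) huv.symm
  have hi0 := R.uIcc_nonneg h hi
  have hk5 : 5 ≤ k := by
    by_contra hlt
    exact hr.not_within (l := k + 2) hi0.1 hi0.2 (by omega) (hk.trans huv).symm
  rw [he] at hne
  have hv6 : Q.Close 6 v s' := (Close.trans huv.symm hl).mono (by omega)
  have h0 := hl.index_le hP hs' hs.le hc0 huv (by omega)
  have h1 := hl.index_le hP hs' hs hc1 huv (by omega)
  -- The leg vertex is at least 5 from its spine end along the leg, so within 4 of component `s'`.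
  -- Thus `v` is within 6 of `s'` and within 4 of `s` and `s + 1`: a centre whenever these indices
  -- are consecutive.
  have hcen : ∀ q, q + 2 ≤ Q.m → (∀ r, q ≤ r → r ≤ q + 2 → r = s ∨ r = s + 1 ∨ r = s') →
      Q.IsCentre q v := by
    refine fun q hq hr => ⟨hq, fun r h1 h2 => ?_⟩
    rcases hr r h1 h2 with rfl | rfl | rfl
    exacts [hc0.mono (by omega), hc1.mono (by omega), hv6]
  obtain rfl | rfl | rfl | rfl : s' = s ∨ s' = s + 1 ∨ s = s' + 1 ∨ s' = s + 2 := by omega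
  · exact hne rfl
  · exact hne hse
  · exact hne ((hcen s' (by omega) (by omega)).side_eq (by omega) (by omega)).symm
  · exact hne ((hcen s (by omega) (by omega)).side_eq (by omega) (by omega))

/-- The vertices used by the path on side `e`. -/
def half (e : Bool) : Set V :=
  {u | (∃ t ≤ Q.m, Q.side t = e ∧ u ∈ P.comp (Q.c t)) ∨
    (∃ t < Q.m, Q.side t = e ∧ u ∈ Q.bridge t) ∨ (∃ q, Q.side q = e ∧ u ∈ Q.star q) ∨
    ∃ t, IsTurn Q t ∧ Q.side t ≠ e ∧ u ∈ R.trunk t}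

theorem not_within_two_of_half (hP : P.Bypassed) {u v : V} (hu : u ∈ R.half true)
    (hv : v ∈ R.half false) : ¬ Within G 2 u v := by
  have hc : ∀ {t v}, v ∈ P.comp (Q.c t) → Q.Close 0 v t := fun h => ⟨_, h, Within.refl _ _⟩
  intro h
  have h' := h.symm
  rcases hu with ⟨t, ht, he, hu⟩ | ⟨t, ht, he, hu⟩ | ⟨q, he, hu⟩ | ⟨t, ht, he, hu⟩ <;>
  rcases hv with ⟨s, hs, hf, hv⟩ | ⟨s, hs, hf, hv⟩ | ⟨r, hf, hv⟩ | ⟨s, hs, hf, hv⟩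
  · exact not_within_two_of_comps ht hs hu hv (by simp [he, hf]) h
  · exact not_within_two_of_bridge_comp hs ht hv hu (by simp [he, hf]) h'
  · exact not_within_two_of_star hP ht hv (hc hu) (by omega) (by simp [he, hf]) h'
  · exact R.not_within_two_of_trunk_comp hs ht hv hu (by simpa [he] using hf) h'
  · exact not_within_two_of_bridge_comp ht hs hu hv (by simp [he, hf]) h
  · exact not_within_two_of_bridges hP ht hs hu hv (by simp [he, hf]) h
  · exact not_within_two_of_star hP ht.le hv (close_of_mem_bridge hu).1 (by omega)
      (by simp [he, hf]) h'
  · exact R.not_within_two_of_trunk_bridge hP hs ht hv hu (by simpa [he] using hf) h'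
  · exact not_within_two_of_star hP hs hu (hc hv) (by omega) (by simp [he, hf]) h
  · exact not_within_two_of_star hP hs.le hu (close_of_mem_bridge hv).1 (by omega)
      (by simp [he, hf]) h
  · have hr := close_of_mem_star hv le_rfl (Nat.le_add_right r 2)
    exact not_within_two_of_star hP (by omega) hu hr.2.1 (by omega) (by simp [he, hf]) h
  · exact R.not_within_two_of_trunk_star hP hs hv hu (by simpa [he] using hf) h'
  · exact R.not_within_two_of_trunk_comp ht hs hu hv (by simpa [hf] using he) h
  · exact R.not_within_two_of_trunk_bridge hP ht hs hu hv (by simpa [hf] using he) h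
  · exact R.not_within_two_of_trunk_star hP ht hu hv (by simpa [hf] using he) h
  · refine R.not_within_two_of_trunks hP ht hs hu hv ?_ h
    simp only [ne_eq, Bool.not_eq_true, Bool.not_eq_false] at he hf
    simp [he, hf]

/-! ### Paths inside the halves -/

theorem comp_subset_half {t : ℕ} (ht : t ≤ Q.m) : P.comp (Q.c t) ⊆ R.half (Q.side t) :=
  fun _ hu => .inl ⟨t, ht, rfl, hu⟩

theorem trunk_subset_half {t : ℕ} (ht : IsTurn Q t) : R.trunk t ⊆ R.half (!Q.side t) :=
  fun _ hu => .inr (.inr (.inr ⟨t, ht, by simp, hu⟩))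

theorem exists_joinedIn_of_merge {t : ℕ} (ht : t < Q.m) (h : Q.Merge t) :
    ∃ x ∈ P.comp (Q.c t), ∃ y ∈ P.comp (Q.c (t + 1)), JoinedIn G (R.half (Q.side t)) x y := by
  rcases h with ⟨x, hx, y, hy, w, hw⟩ | ⟨q, z, h1, h2, hz⟩
  · refine ⟨x, hx, y, hy, w, fun u hu => .inr (.inl ⟨t, ht, rfl, ?_⟩)⟩
    obtain ⟨k, l, hkl, hk, hl⟩ := within_of_mem_support w hu
    exact ⟨k, l, by omega, ⟨x, hx, hk.symm⟩, y, hy, hl⟩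
  · have key : ∀ r, q ≤ r → r ≤ q + 2 → ∃ y ∈ P.comp (Q.c r),
        JoinedIn G (R.half (Q.side t)) z y := by
      intro r hr hr'
      obtain ⟨y, hy, w, hw⟩ := hz.2 r hr hr'
      refine ⟨y, hy, w, fun u hu => .inr (.inr (.inl ⟨q, (hz.side_eq h1 (by omega)).symm, ?_⟩))⟩
      obtain ⟨k, l, hkl, hk, hl⟩ := within_of_mem_support w hu
      exact ⟨z, hz, hk.mono (by omega), r, hr, hr', y, hy, hl.mono (by omega)⟩
    obtain ⟨x, hx, hzx⟩ := key t h1 (by omega)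
    obtain ⟨y, hy, hzy⟩ := key (t + 1) (by omega) (by omega)
    exact ⟨x, hx, y, hy, hzx.symm.trans hzy⟩

theorem exists_joinedIn_trunk {t s : ℕ} (hs : s ≤ Q.m) (hne : Q.side s ≠ Q.side t) {i : ℤ}
    (hi : i ∈ Set.uIcc (R.head t) (R.a t)) (h0 : 0 ≤ i) (hn : i ≤ P.n)
    (ha : i ∈ P.att (Q.c s)) : ∃ y ∈ P.comp (Q.c s), JoinedIn G (R.trunk t) (P.p i) y := by
  rcases ha with ⟨-, -, y, hy, hw⟩ | ⟨h, -⟩ | ⟨h, -⟩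
  · obtain ⟨w, hw⟩ := hw.symm
    refine ⟨y, hy, w, fun u hu => ⟨i, hi, .inr ⟨s, hs, hne, ?_⟩⟩⟩
    obtain ⟨k, l, hkl, hk, hl⟩ := within_of_mem_support w hu
    exact ⟨k, l, by omega, hk, y, hy, hl⟩
  · omega
  · omega

theorem joinedIn_trunk {t : ℕ} (h : IsTurn Q t) :
    JoinedIn G (R.trunk t) (P.p (R.head t)) (P.p (R.a t)) := by
  have h1 := R.head_nonneg h.1
  have h2 := R.a_nonneg' h
  exact P.joinedIn_uIcc h1.1 h1.2 h2.1 h2.2 fun l hl => ⟨l, hl, .inl rfl⟩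

/-- Both halves lead from `S` past each component: one inside the component, the other to the
current position on the spine. -/
theorem exists_joinedIn_half {t : ℕ} (ht : t ≤ Q.m) :
    (∃ s ∈ S, ∀ v ∈ P.comp (Q.c t), JoinedIn G (R.half (Q.side t)) s v) ∧
      ∀ v, JoinedIn G (R.half (!Q.side t)) (P.p (R.head t)) v →
        ∃ s ∈ S, JoinedIn G (R.half (!Q.side t)) s v := by
  induction t with
  | zero =>
    -- The conditional form of the second claim makes it immediate here: `p 0` need not first be
    -- shown to lie in the half.
    refine ⟨?_, fun v hv => ⟨_, P.mem_S, hv⟩⟩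
    obtain ⟨s, hs, hsS⟩ := Q.meets_S
    exact ⟨s, hsS, fun v hv => (joinedIn_comp hs hv).mono (R.comp_subset_half ht)⟩
  | succ t ih =>
    obtain ⟨⟨s, hs, hsv⟩, hsp⟩ := ih (by omega)
    by_cases h : Q.Merge t
    · have hh : R.head (t + 1) = R.head t := by simp [head, h]
      have hsd := side_succ_of_merge h
      refine ⟨⟨s, hs, fun v hv => ?_⟩, by rw [hh, hsd]; exact hsp⟩
      obtain ⟨x, hx, y, hy, hxy⟩ := R.exists_joinedIn_of_merge ht h
      have := (joinedIn_comp hy hv).mono (R.comp_subset_half ht)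
      rw [hsd] at this ⊢
      exact ((hsv x hx).trans hxy).trans this
    · have hh : R.head (t + 1) = R.b t := by simp [head, h]
      have hsd := side_succ_of_not_merge h
      have hturn : IsTurn Q t := ⟨by omega, fun _ => h⟩
      constructor
      · have ha := R.a_nonneg ht h
        obtain ⟨y, hy, hay⟩ := R.exists_joinedIn_trunk (s := t + 1) (t := t) ht (by simp [hsd])
          Set.right_mem_uIcc ha.1 ha.2 (R.mem_a t ht h)
        obtain ⟨s', hs', hsy⟩ := hsp y
          (((R.joinedIn_trunk hturn).trans hay).mono (R.trunk_subset_half hturn))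
        refine ⟨s', hs', fun v hv => ?_⟩
        have := (joinedIn_comp hy hv).mono (R.comp_subset_half ht)
        rw [hsd] at this ⊢
        exact hsy.trans this
      · intro v hv
        -- The leg from component `t` down to `b t` belongs to the trunk of the next turn, whose
        -- stretch starts at `b t`.
        obtain ⟨t', ht', hhd, hsd'⟩ := R.exists_isTurn ht
        have hb := R.b_nonneg ht h
        obtain ⟨y, hy, hby⟩ := R.exists_joinedIn_trunk (s := t) (t := t') (by omega)
          (by simp [hsd', hsd]) (i := R.b t) (by rw [hhd, hh]; exact Set.left_mem_uIcc) hb.1 hb.2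
          (R.mem_b t ht h)
        have hby' := hby.mono (R.trunk_subset_half ht')
        rw [hsd', hsd, Bool.not_not] at hby'
        rw [hh, hsd, Bool.not_not] at hv
        rw [hsd, Bool.not_not]
        exact ⟨s, hs, ((hsv y hy).trans hby'.symm).trans hv⟩

theorem exists_pathBetween_subset_half (e : Bool) : ∃ A : PathBetween G S T, A.verts ⊆ R.half e := by
  obtain ⟨⟨s, hs, hsv⟩, hsp⟩ := R.exists_joinedIn_half le_rfl
  by_cases he : Q.side Q.m = e
  · obtain ⟨v, hv, hvT⟩ := Q.meets_T
    exact (he ▸ hsv v hv).exists_pathBetween hs hvT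
  · have hturn : IsTurn Q Q.m := ⟨le_rfl, fun h => absurd h (lt_irrefl _)⟩
    obtain ⟨s', hs', h⟩ := hsp _ ((R.joinedIn_trunk hturn).mono (R.trunk_subset_half hturn))
    rw [R.a_m] at h
    have he' : (!Q.side Q.m) = e := by cases e <;> simpa using he
    exact (he' ▸ h).exists_pathBetween hs' P.mem_T

end Turns
end MinChain

theorem Bypassed.exists_distant_paths (h : P.Bypassed) :
    ∃ A B : PathBetween G S T, 3 ≤ setDist G A.verts B.verts := by
  obtain ⟨Q⟩ := h.exists_minChain
  obtain ⟨R⟩ := Q.exists_turns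
  obtain ⟨A, hA⟩ := R.exists_pathBetween_subset_half true
  obtain ⟨B, hB⟩ := R.exists_pathBetween_subset_half false
  exact ⟨A, B, three_le_setDist fun x hx y hy => R.not_within_two_of_half h (hA hx) (hB hy)⟩

end Spine
end CoarseMenger

open CoarseMenger in
theorem theorem3p4 {V : Type*} [Nonempty V] (G : SimpleGraph V) (S T : Set V) :
    (∃ P Q : PathBetween G S T, 3 ≤ setDist G P.verts Q.verts) ∨
      ∃ x : V, ∀ P : PathBetween G S T, ∃ v ∈ P.verts, G.edist v x ≤ 161 := by
  by_cases hST : ∃ s ∈ S, ∃ t ∈ T, G.Reachable s t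
  · obtain ⟨P⟩ := exists_spine hST
    by_cases hx : ∃ x : V, ∀ A : PathBetween G S T, ∃ v ∈ A.verts, G.edist v x ≤ 161
    · exact .inr hx
    · refine .inl (Spine.Bypassed.exists_distant_paths (P := P) (Spine.bypassed fun i _ _ => ?_))
      push Not at hx
      obtain ⟨A, hA⟩ := hx (P.p i)
      exact ⟨A.source, A.source_mem, A.target, A.target_mem, A.path,
        fun z hz hw => (hA z hz).not_ge (within_iff_edist_le.1 hw)⟩
  · obtain ⟨x⟩ := ‹Nonempty V›
    exact .inr ⟨x, fun A => absurd ⟨_, A.source_mem, _, A.target_mem, ⟨A.path⟩⟩ hST⟩
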